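/- \textbf{Conventions.} A \emph{concrete operator system} is a closed subspace $X$ of a unital $C^*$-algebra that is stable under the adjoint operation and contains the unit; $\mathcal S(X)$ denotes its state space (positive linear functionals preserving the unit) with the weak$^*$-topology. A \emph{compact quantum metric space} is a pair $(X,L)$ of a concrete operator system $X$ and a seminorm $L\colon X\to[0,\infty]$ such that (i) $L(x)=0$ if and only if $x\in\mathbb C\cdot 1$; (ii) $\mathrm{Dom}(L):=\{x\in X: L(x)<\infty\}$ is dense in $X$ and $L(x^*)=L(x)$ for all $x\in X$; (iii) $\rho_L(\mu,\nu):=\sup\{|\mu(x)-\nu(x)| : x\in X,\ L(x)\le 1\}$ is a metric on $\mathcal S(X)$ that metrises the weak$^*$-topology. An \emph{order unit compact quantum metric space} is a pair $(A,L)$ of an order unit space $A$ with order unit $e$ and a finite seminorm $L\colon A\to[0,\infty)$ such that $L(a)=0$ if and only if $a\in\mathbb R e$, and such that $\rho_L(\mu,\nu):=\sup\{|\mu(a)-\nu(a)| : a\in A,\ L(a)\le 1\}$ is a metric that metrises the weak$^*$-topology on the state space $\mathcal S(A)$ (positive linear functionals with value $1$ at $e$). Given compact quantum metric spaces $(X,L_X)$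 and $(Y,L_Y)$, put $A:=X_{\mathrm{sa}}\cap\mathrm{Dom}(L_X)$ and $B:=Y_{\mathrm{sa}}\cap\mathrm{Dom}(L_Y)$, with the order and unit of the ambient $C^*$-algebras. A seminorm $M\colon A\oplus B\to[0,\infty)$ is \emph{admissible} if $(A\oplus B,M)$ is an order unit compact quantum metric space (componentwise order, order unit $(1,1)$) and $\inf_{b\in B}M(a,b)=L_X(a)$ for all $a\in A$ and $\inf_{a\in A}M(a,b)=L_Y(b)$ for all $b\in B$. The \emph{quantum Gromov--Hausdorff distance} $\mathrm{dist}_{\mathrm Q}\big((X,L_X);(Y,L_Y)\big)$ is the infimum, over all admissible $M$, of the Hausdorff distance with respect to $\rho_M$ between the images of $\mathcal S(A)$ and $\mathcal S(B)$ in $\mathcal S(A\oplus B)$ under the maps dual to the coordinate projections. \textbf{Lemma.} Let $(X,L)$ be a compact quantum metric space and let $Y\subseteq X$ be a sub-operator system equipped with a seminorm $K\colon Y\to[0,\infty]$ whose domain $\mathrm{Dom}(K):=\{y\in Y: K(y)<\infty\}$ is dense in $Y$, $*$-invariant and contained in $\mathrm{Dom}(L)$, and such that $K(y)=L(y)$ for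 all $y\in\mathrm{Dom}(K)$. Let $\varepsilon>0$. If for every $x\in X$ there exists $y\in Y$ such that $K(y)\le L(x)$ and $\|x-y\|\le\varepsilon L(x)$, then $(Y,K)$ is a compact quantum metric space and $\mathrm{dist}_{\mathrm Q}\big((X,L);(Y,K)\big)\le\varepsilon$. -/

import Mathlib

open scoped ENNReal

noncomputable section

/-- The extended-real valued function `ρ` is (the distance function of) a genuine, finite metric
which induces the given topology. -/
def MetrisesTopology {S : Type*} [t : TopologicalSpace S] (ρ : S → S → ℝ≥0∞) : Prop :=
  ∃ m : MetricSpace S, (∀ μ ν : S, ENNReal.ofReal (m.dist μ ν) = ρ μ ν) ∧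
    m.toUniformSpace.toTopologicalSpace = t

/-! ### Order unit spaces and order unit compact quantum metric spaces -/

/-- `A` with its partial order and the distinguished element `e` is an order unit space:
a real partially ordered vector space, in which `e` is an Archimedean order unit. -/
structure IsOrderUnitSpace (A : Type*) [AddCommGroup A] [Module ℝ A] [PartialOrder A]
    (e : A) : Prop where
  add_le_add_right : ∀ a b c : A, a ≤ b → a + c ≤ b + c
  smul_nonneg : ∀ (t : ℝ) (a : A), 0 ≤ t → 0 ≤ a → 0 ≤ t • a
  exists_le_smul : ∀ a : A, ∃ t : ℝ, a ≤ t • e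
  archimedean : ∀ a : A, (∀ t : ℝ, 0 < t → a ≤ t • e) → a ≤ 0

/-- States of `(A, e)`: positive linear functionals that send the order unit `e` to `1`. -/
def OrderUnitState (A : Type*) [AddCommGroup A] [Module ℝ A] [PartialOrder A] (e : A) : Type _ :=
  {μ : A →ₗ[ℝ] ℝ // (∀ a : A, 0 ≤ a → 0 ≤ μ a) ∧ μ e = 1}

section OrderUnit

variable {A : Type*} [AddCommGroup A] [Module ℝ A] [PartialOrder A] {e : A}
variable {B : Type*} [AddCommGroup B] [Module ℝ B] [PartialOrder B] {e' : B}

/-- The weak-* topology (pointwise convergence) on the state space. -/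
instance OrderUnitState.instTopologicalSpace : TopologicalSpace (OrderUnitState A e) :=
  TopologicalSpace.induced (fun (μ : OrderUnitState A e) (a : A) => μ.1 a) Pi.topologicalSpace

/-- The Monge-Kantorovich distance of two states, as an extended real. -/
def OrderUnitState.mkDist (L : Seminorm ℝ A) (μ ν : OrderUnitState A e) : ℝ≥0∞ :=
  ⨆ a : A, ⨆ _ : L a ≤ 1, ‖μ.1 a - ν.1 a‖ₑ

/-- The extended pseudo-metric structure on the state space given by `mkDist`. -/
abbrev OrderUnitState.mkPseudoEMetricSpace (L : Seminorm ℝ A) :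
    PseudoEMetricSpace (OrderUnitState A e) where
  edist := OrderUnitState.mkDist L
  edist_self μ := by simp [OrderUnitState.mkDist]
  edist_comm μ ν := by
    simp only [OrderUnitState.mkDist]
    refine iSup_congr fun a => iSup_congr fun _ => ?_
    rw [← enorm_neg, neg_sub]
  edist_triangle μ ν κ := by
    refine iSup₂_le fun a ha => ?_
    have h : μ.1 a - κ.1 a = (μ.1 a - ν.1 a) + (ν.1 a - κ.1 a) := by ring
    rw [h]
    refine (enorm_add_le _ _).trans (add_le_add ?_ ?_)
    · exact le_iSup₂ (f := fun (a : A) (_ : L a ≤ 1) => ‖μ.1 a - ν.1 a‖ₑ) a ha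
    · exact le_iSup₂ (f := fun (a : A) (_ : L a ≤ 1) => ‖ν.1 a - κ.1 a‖ₑ) a ha

variable (e) in
/-- `(A, e)` with the finite seminorm `L` is an order unit compact quantum metric space. -/
structure IsOrderUnitCQMS (L : Seminorm ℝ A) : Prop where
  isOrderUnitSpace : IsOrderUnitSpace A e
  eq_zero_iff : ∀ a : A, L a = 0 ↔ ∃ t : ℝ, a = t • e
  metrises : MetrisesTopology (OrderUnitState.mkDist L : OrderUnitState A e → _ → ℝ≥0∞)

/-- The embedding `S(A) → S(A ⊕ B)` dual to the first projection. -/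
def OrderUnitState.inl (μ : OrderUnitState A e) : OrderUnitState (A × B) (e, e') :=
  ⟨μ.1.comp (LinearMap.fst ℝ A B), fun c hc => μ.2.1 c.1 hc.1, μ.2.2⟩

/-- The embedding `S(B) → S(A ⊕ B)` dual to the second projection. -/
def OrderUnitState.inr (ν : OrderUnitState B e') : OrderUnitState (A × B) (e, e') :=
  ⟨ν.1.comp (LinearMap.snd ℝ A B), fun c hc => ν.2.1 c.2 hc.2, ν.2.2⟩

variable (e e') in
/-- A seminorm on `A ⊕ B` (componentwise order, order unit `(e, e')`) is admissible for `LA`, `LB`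
if it is a Lip-norm whose quotient seminorms on `A` and `B` are `LA` and `LB`. -/
structure IsAdmissible (LA : Seminorm ℝ A) (LB : Seminorm ℝ B) (L : Seminorm ℝ (A × B)) :
    Prop where
  isOrderUnitCQMS : IsOrderUnitCQMS (e, e') L
  quotient_left : ∀ a : A, ⨅ b : B, L (a, b) = LA a
  quotient_right : ∀ b : B, ⨅ a : A, L (a, b) = LB b

variable (e e') in
/-- The Hausdorff distance of `S(A)` and `S(B)` inside `S(A ⊕ B)` with the Monge-Kantorovich
distance of `L`. -/
def stateHausdorffDist (L : Seminorm ℝ (A × B)) : ℝ≥0∞ :=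
  letI : PseudoEMetricSpace (OrderUnitState (A × B) (e, e')) :=
    OrderUnitState.mkPseudoEMetricSpace L
  Metric.hausdorffEDist
    (Set.range (OrderUnitState.inl : OrderUnitState A e → OrderUnitState (A × B) (e, e')))
    (Set.range (OrderUnitState.inr : OrderUnitState B e' → OrderUnitState (A × B) (e, e')))

variable (e e') in
/-- The quantum Gromov-Hausdorff distance of `(A, LA)` and `(B, LB)`. -/
def orderUnitQGHDist (LA : Seminorm ℝ A) (LB : Seminorm ℝ B) : ℝ≥0∞ :=
  ⨅ L : Seminorm ℝ (A × B), ⨅ _ : IsAdmissible e e' LA LB L, stateHausdorffDist e e' L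

end OrderUnit

/-! ### Operator systems and compact quantum metric spaces -/

/-- A seminorm with values in `[0, ∞]` on a complex vector space (with `0 * ∞ = 0`). -/
structure ExtSeminorm (E : Type*) [AddCommGroup E] [Module ℂ E] where
  toFun : E → ℝ≥0∞
  add_le' : ∀ x y : E, toFun (x + y) ≤ toFun x + toFun y
  smul' : ∀ (c : ℂ) (x : E), toFun (c • x) = ‖c‖ₑ * toFun x

instance ExtSeminorm.instCoeFun (E : Type*) [AddCommGroup E] [Module ℂ E] :
    CoeFun (ExtSeminorm E) (fun _ => E → ℝ≥0∞) := ⟨ExtSeminorm.toFun⟩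

/-- A concrete operator system: a closed, adjoint-stable subspace containing the unit. -/
structure ConcreteOperatorSystem (𝔄 : Type*) [CStarAlgebra 𝔄] extends Submodule ℂ 𝔄 where
  isClosed' : IsClosed (carrier : Set 𝔄)
  star_mem' : ∀ {x : 𝔄}, x ∈ carrier → star x ∈ carrier
  one_mem' : (1 : 𝔄) ∈ carrier

namespace ConcreteOperatorSystem

variable {𝔄 : Type*} [CStarAlgebra 𝔄]

/-- The unit of an operator system. -/
def unit (X : ConcreteOperatorSystem 𝔄) : X.toSubmodule := ⟨1, X.one_mem'⟩

/-- The adjoint operation of an operator system. -/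
def adj (X : ConcreteOperatorSystem 𝔄) (x : X.toSubmodule) : X.toSubmodule :=
  ⟨star (x : 𝔄), X.star_mem' x.2⟩

/-- States of an operator system: linear functionals that preserve the unit and take real,
non-negative values on the elements that are positive in the ambient algebra. -/
def State [PartialOrder 𝔄] (X : ConcreteOperatorSystem 𝔄) : Type _ :=
  {μ : X.toSubmodule →ₗ[ℂ] ℂ //
    (∀ x : X.toSubmodule, 0 ≤ (x : 𝔄) → 0 ≤ (μ x).re ∧ (μ x).im = 0) ∧ μ X.unit = 1}

/-- The weak-* topology (pointwise convergence) on the state space. -/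
instance State.instTopologicalSpace [PartialOrder 𝔄] (X : ConcreteOperatorSystem 𝔄) :
    TopologicalSpace X.State :=
  TopologicalSpace.induced (fun (μ : X.State) (x : X.toSubmodule) => μ.1 x) Pi.topologicalSpace

/-- The Monge-Kantorovich distance of two states, as an extended real. -/
def State.mkDist [PartialOrder 𝔄] {X : ConcreteOperatorSystem 𝔄} (L : ExtSeminorm X.toSubmodule)
    (μ ν : X.State) : ℝ≥0∞ :=
  ⨆ x : X.toSubmodule, ⨆ _ : L x ≤ 1, ‖μ.1 x - ν.1 x‖ₑ

/-- `(X, L)` is a compact quantum metric space. -/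
structure IsCQMS [PartialOrder 𝔄] (X : ConcreteOperatorSystem 𝔄)
    (L : ExtSeminorm X.toSubmodule) : Prop where
  eq_zero_iff : ∀ x : X.toSubmodule, L x = 0 ↔ ∃ c : ℂ, x = c • X.unit
  dense_dom : Dense {x : X.toSubmodule | L x < ∞}
  adj_eq : ∀ x : X.toSubmodule, L (X.adj x) = L x
  metrises : MetrisesTopology (State.mkDist L : X.State → X.State → ℝ≥0∞)

/-- The real vector space `A = X_sa ∩ Dom(L)`. -/
def lipSelfAdjoint (X : ConcreteOperatorSystem 𝔄) (L : ExtSeminorm X.toSubmodule) :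
    Submodule ℝ X.toSubmodule where
  carrier := {x | IsSelfAdjoint (x : 𝔄) ∧ L x < ∞}
  add_mem' := fun {x y} hx hy =>
    ⟨hx.1.add hy.1, (L.add_le' x y).trans_lt (ENNReal.add_lt_top.2 ⟨hx.2, hy.2⟩)⟩
  zero_mem' := by
    refine ⟨IsSelfAdjoint.zero 𝔄, ?_⟩
    have h := L.smul' 0 0
    simp only [zero_smul, enorm_zero, zero_mul] at h
    rw [h]
    exact ENNReal.zero_lt_top
  smul_mem' := fun t x hx => by
    refine ⟨(IsSelfAdjoint.all t).smul hx.1, ?_⟩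
    have h : t • x = (t : ℂ) • x := Subtype.ext (Complex.coe_smul t (x : 𝔄)).symm
    rw [h, L.smul']
    exact ENNReal.mul_lt_top enorm_lt_top hx.2

/-- The restriction of `L` to `A = X_sa ∩ Dom(L)`, a finite real seminorm. -/
def lipSeminorm (X : ConcreteOperatorSystem 𝔄) (L : ExtSeminorm X.toSubmodule) :
    Seminorm ℝ (X.lipSelfAdjoint L) :=
  Seminorm.of (fun a => (L a.1).toReal)
    (fun a b => by
      rw [← ENNReal.toReal_add a.2.2.ne b.2.2.ne]
      exact ENNReal.toReal_mono (ENNReal.add_lt_top.2 ⟨a.2.2, b.2.2⟩).ne (L.add_le' a.1 b.1))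
    (fun t a => by
      have h : (t • a).1 = (t : ℂ) • a.1 :=
        Subtype.ext (Complex.coe_smul t (a.1 : 𝔄)).symm
      rw [h, L.smul', ENNReal.toReal_mul]
      simp)

/-- The order unit of `A = X_sa ∩ Dom(L)`; the order of `A` is the one of the ambient algebra. -/
def lipUnit [PartialOrder 𝔄] {X : ConcreteOperatorSystem 𝔄} {L : ExtSeminorm X.toSubmodule}
    (hL : X.IsCQMS L) : X.lipSelfAdjoint L :=
  ⟨X.unit, IsSelfAdjoint.one 𝔄, by
    rw [(hL.eq_zero_iff X.unit).2 ⟨1, (one_smul _ _).symm⟩]; exact ENNReal.zero_lt_top⟩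

/-- The quantum Gromov-Hausdorff distance of two compact quantum metric spaces. -/
def qGHDist {𝔅 : Type*} [CStarAlgebra 𝔅] [PartialOrder 𝔄] [PartialOrder 𝔅]
    {X : ConcreteOperatorSystem 𝔄} {L : ExtSeminorm X.toSubmodule}
    {Y : ConcreteOperatorSystem 𝔅} {K : ExtSeminorm Y.toSubmodule}
    (hL : X.IsCQMS L) (hK : Y.IsCQMS K) : ℝ≥0∞ :=
  orderUnitQGHDist (lipUnit hL) (lipUnit hK) (X.lipSeminorm L) (Y.lipSeminorm K)

end ConcreteOperatorSystem

end

/-! Put M(a,b) = max{L(a), K(b), ‖a−b‖/ε} on A ⊕ B (`bridgeSeminorm`). Its quotient on B is K, since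
b itself lies in A with L(b) = K(b). Its quotient on A is L, since every a has an approximant in Y,
which may be taken self-adjoint. Every state of A and every state of B is the restriction of a state
of X, and the two restrictions of one state differ by at most ‖a−b‖ ≤ ε on pairs with M(a,b) ≤ 1. So
the Hausdorff distance is at most ε.

It remains to see that ρ_K and ρ_M metrise the weak* topologies. Both cases follow from
`metrisesTopology_of_surjective`: a finite ρ, finer than the weak* topology, metrises it once the
state space is a ρ-continuous image of a compact space. For ρ_K that map is restriction from S(X).
For ρ_M it is (μ,ν,t) ↦ tμ ⊕ (1−t)ν on S(X) × S(X) × [0,1] (`mixedState_surjective`,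
`mkDist_mixedState_le`). Surjectivity rests each time on `State.exists_extension`, an application of
the M. Riesz extension theorem. -/

open Topology Filter

/-! ### A compactness criterion for metrising a topology -/

/-- An extended pseudo-metric with finite values, whose topology is finer than a given Hausdorff
topology and which is compact as a continuous image of a compact space, metrises that topology. -/
theorem metrisesTopology_of_surjective {Z S : Type*} [TopologicalSpace Z]
    [CompactSpace Z] [t : TopologicalSpace S] [T2Space S] (P : PseudoEMetricSpace S)
    (hfin : ∀ μ ν : S, P.edist μ ν ≠ ∞) (hle : P.toUniformSpace.toTopologicalSpace ≤ t)
    (f : Z → S) (hf : ∀ z, Tendsto (fun z' => P.edist (f z') (f z)) (𝓝 z) (𝓝 0))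
    (hsurj : Function.Surjective f) : MetrisesTopology P.edist := by
  have hcompact : @CompactSpace S P.toUniformSpace.toTopologicalSpace := by
    let _ := P.toUniformSpace.toTopologicalSpace
    refine hsurj.compactSpace (continuous_iff_continuousAt.2 fun z => ?_)
    exact (@tendsto_iff_edist_tendsto_0 S Z P _ _ _).2 (hf z)
  -- The identity is a continuous bijection from a compact to a Hausdorff space, hence closed, hence
  -- a homeomorphism.
  have heq : P.toUniformSpace.toTopologicalSpace = t := by
    refine le_antisymm hle ?_
    have hcl : @IsClosedMap S S P.toUniformSpace.toTopologicalSpace t id :=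
      @Continuous.isClosedMap S S P.toUniformSpace.toTopologicalSpace t hcompact _ id
        (continuous_id_iff_le.2 hle)
    refine continuous_id_iff_le.1 ?_
    refine (@continuous_iff_isClosed S S t P.toUniformSpace.toTopologicalSpace id).2 fun s hs => ?_
    simpa using hcl s hs
  -- Separation of points is inherited from `t`; it need not be checked on the distance.
  have hT0 : @T0Space S P.toUniformSpace.toTopologicalSpace := by
    rw [heq]; infer_instance
  let Q : PseudoMetricSpace S := @PseudoEMetricSpace.toPseudoMetricSpace S P hfin
  let m : MetricSpace S := @MetricSpace.ofT0PseudoMetricSpace S Q hT0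
  exact ⟨m, fun μ ν => ENNReal.ofReal_toReal (hfin μ ν), heq⟩

theorem MetrisesTopology.ne_top {S : Type*} [TopologicalSpace S] {ρ : S → S → ℝ≥0∞}
    (h : MetrisesTopology ρ) (μ ν : S) : ρ μ ν ≠ ∞ := by
  obtain ⟨m, hm, -⟩ := h
  rw [← hm]
  exact ENNReal.ofReal_ne_top

theorem MetrisesTopology.tendsto_zero {S : Type*} [TopologicalSpace S] {ρ : S → S → ℝ≥0∞}
    (h : MetrisesTopology ρ) (μ : S) : Tendsto (fun ν => ρ ν μ) (𝓝 μ) (𝓝 0) := by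
  obtain ⟨m, hm, rfl⟩ := h
  simp only [← hm]
  have := (ENNReal.continuous_ofReal.comp
    (continuous_id.dist (continuous_const (y := μ)))).tendsto μ
  simpa [Function.comp_def] using this

/-- A function that is Lipschitz with finite constant is continuous. -/
theorem continuous_of_enorm_sub_le {S E : Type*} [PseudoEMetricSpace S] [SeminormedAddCommGroup E]
    {C : ℝ≥0∞} (hC : C ≠ ∞) {g : S → E} (h : ∀ μ ν, ‖g μ - g ν‖ₑ ≤ C * edist μ ν) :
    Continuous g := by
  lift C to NNReal using hC
  exact LipschitzWith.continuous (K := C) fun μ ν => by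
    rw [edist_eq_enorm_sub]; exact h μ ν

/-! ### States of an operator system: bounds, compactness, extension -/

namespace ExtSeminorm

variable {E : Type*} [AddCommGroup E] [Module ℂ E]

theorem ofReal_smul (L : ExtSeminorm E) {r : ℝ} (hr : 0 ≤ r) (x : E) :
    L ((r : ℂ) • x) = ENNReal.ofReal r * L x := by
  rw [L.smul', ← ofReal_norm, Complex.norm_real, Real.norm_of_nonneg hr]

end ExtSeminorm

namespace ConcreteOperatorSystem

variable {𝔄 : Type*} [CStarAlgebra 𝔄]

theorem adj_adj (X : ConcreteOperatorSystem 𝔄) (x : X.toSubmodule) : X.adj (X.adj x) = x :=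
  Subtype.ext (star_star _)

theorem isSelfAdjoint_I_smul_sub_adj (X : ConcreteOperatorSystem 𝔄) (x : X.toSubmodule) :
    IsSelfAdjoint ((Complex.I • (x - X.adj x) : X.toSubmodule) : 𝔄) := by
  simp only [isSelfAdjoint_iff, adj, Submodule.coe_smul, Submodule.coe_sub, star_smul, star_sub,
    star_star, Complex.star_def, Complex.conj_I, neg_smul, smul_sub]
  abel

variable [PartialOrder 𝔄] {X Y : ConcreteOperatorSystem 𝔄}

/-- The extended pseudo-metric structure on the state space given by `mkDist`. -/
noncomputable abbrev State.mkPseudoEMetricSpace (L : ExtSeminorm X.toSubmodule) :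
    PseudoEMetricSpace X.State where
  edist := State.mkDist L
  edist_self μ := by simp [State.mkDist]
  edist_comm μ ν := by
    simp only [State.mkDist]
    refine iSup_congr fun a => iSup_congr fun _ => ?_
    rw [← enorm_neg, neg_sub]
  edist_triangle μ ν κ := by
    refine iSup₂_le fun a ha => ?_
    rw [← sub_add_sub_cancel _ (ν.1 a)]
    refine (enorm_add_le _ _).trans (add_le_add ?_ ?_)
    · exact le_iSup₂ (f := fun (a : X.toSubmodule) (_ : L a ≤ 1) => ‖μ.1 a - ν.1 a‖ₑ) a ha
    · exact le_iSup₂ (f := fun (a : X.toSubmodule) (_ : L a ≤ 1) => ‖ν.1 a - κ.1 a‖ₑ) a ha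

theorem State.enorm_sub_le_mkDist (L : ExtSeminorm X.toSubmodule) (μ ν : X.State)
    {x : X.toSubmodule} (hx : L x ≤ 1) : ‖μ.1 x - ν.1 x‖ₑ ≤ State.mkDist L μ ν :=
  le_iSup₂ (f := fun (a : X.toSubmodule) (_ : L a ≤ 1) => ‖μ.1 a - ν.1 a‖ₑ) x hx

/-- Normalise `x` by `L x`. The case `L x = 0` is excluded because the right side would then be `0`,
even at infinite distance. -/
theorem State.enorm_sub_le_mul_mkDist (L : ExtSeminorm X.toSubmodule) (μ ν : X.State)
    {x : X.toSubmodule} (h0 : L x ≠ 0) (hx : L x ≠ ∞) :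
    ‖μ.1 x - ν.1 x‖ₑ ≤ L x * State.mkDist L μ ν := by
  have hpos : 0 < (L x).toReal := ENNReal.toReal_pos h0 hx
  have hle : L ((((L x).toReal)⁻¹ : ℝ) • x : X.toSubmodule) ≤ 1 := by
    have hs : (((L x).toReal)⁻¹ : ℝ) • x = ((((L x).toReal)⁻¹ : ℝ) : ℂ) • x :=
      (Complex.coe_smul _ x).symm
    rw [hs, L.ofReal_smul (inv_nonneg.2 hpos.le), ENNReal.ofReal_inv_of_pos hpos,
      ENNReal.ofReal_toReal hx, ENNReal.inv_mul_cancel h0 hx]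
  have h := State.enorm_sub_le_mkDist L μ ν hle
  have hs : (((L x).toReal)⁻¹ : ℝ) • x = ((((L x).toReal)⁻¹ : ℝ) : ℂ) • x :=
    (Complex.coe_smul _ x).symm
  rw [hs, map_smul, map_smul, ← smul_sub, enorm_smul, ← ofReal_norm (_ : ℂ), Complex.norm_real,
    Real.norm_of_nonneg (inv_nonneg.2 hpos.le), ENNReal.ofReal_inv_of_pos hpos,
    ENNReal.ofReal_toReal hx] at h
  calc ‖μ.1 x - ν.1 x‖ₑ = L x * ((L x)⁻¹ * ‖μ.1 x - ν.1 x‖ₑ) := by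
        rw [← mul_assoc, ENNReal.mul_inv_cancel h0 hx, one_mul]
    _ ≤ _ := by gcongr

instance State.instT2Space : T2Space X.State :=
  T2Space.of_injective_continuous (f := fun (μ : X.State) (x : X.toSubmodule) => μ.1 x)
    (fun _ _ h => Subtype.ext (LinearMap.ext fun x => congrFun h x)) continuous_induced_dom

/-- The restriction of a state to a sub-operator system. -/
noncomputable def State.restrict (h : Y.toSubmodule ≤ X.toSubmodule) (μ : X.State) : Y.State :=
  ⟨μ.1 ∘ₗ Submodule.inclusion h, fun _ hy => μ.2.1 _ hy, μ.2.2⟩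

/-- The unit ball of `K` sits inside that of `L`, so the supremum for `K` runs over fewer elements.
-/
theorem State.mkDist_restrict_le {L : ExtSeminorm X.toSubmodule}
    {hYX : Y.toSubmodule ≤ X.toSubmodule} {K : ExtSeminorm Y.toSubmodule}
    (hKL : ∀ y : Y.toSubmodule, K y < ∞ → K y = L (Submodule.inclusion hYX y)) (μ ν : X.State) :
    State.mkDist K (μ.restrict hYX) (ν.restrict hYX) ≤ State.mkDist L μ ν := by
  refine iSup₂_le fun y hy => ?_
  refine State.enorm_sub_le_mkDist L μ ν (x := Submodule.inclusion hYX y) ?_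
  rw [← hKL y (hy.trans_lt ENNReal.one_lt_top)]
  exact hy

variable [StarOrderedRing 𝔄]

/-- Both claims come from the positivity of ‖a‖·1 − a, which lies in `X`. -/
theorem State.re_le_norm_and_im_eq_zero (μ : X.State) {a : X.toSubmodule}
    (ha : IsSelfAdjoint (a : 𝔄)) : (μ.1 a).re ≤ ‖(a : 𝔄)‖ ∧ (μ.1 a).im = 0 := by
  have hle : (0 : 𝔄) ≤ (((‖(a : 𝔄)‖ : ℂ) • X.unit - a : X.toSubmodule) : 𝔄) := by
    have := ha.le_algebraMap_norm_self
    rw [Algebra.algebraMap_eq_smul_one, ← sub_nonneg] at this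
    simpa [unit] using this
  have h := μ.2.1 _ hle
  rw [map_sub, map_smul, μ.2.2] at h
  simpa using h

theorem State.abs_re_le_norm (μ : X.State) {a : X.toSubmodule} (ha : IsSelfAdjoint (a : 𝔄)) :
    |(μ.1 a).re| ≤ ‖(a : 𝔄)‖ := by
  have h1 := (μ.re_le_norm_and_im_eq_zero ha).1
  have h2 := (μ.re_le_norm_and_im_eq_zero (a := -a) (by simpa using ha.neg)).1
  simp only [map_neg, Complex.neg_re, Submodule.coe_neg, norm_neg] at h2
  exact abs_le.2 ⟨by linarith, h1⟩

theorem State.norm_le_of_isSelfAdjoint (μ : X.State) {a : X.toSubmodule}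
    (ha : IsSelfAdjoint (a : 𝔄)) : ‖μ.1 a‖ ≤ ‖(a : 𝔄)‖ := by
  have h : μ.1 a = ((μ.1 a).re : ℂ) :=
    Complex.ext rfl (by simpa using (μ.re_le_norm_and_im_eq_zero ha).2)
  rw [h, Complex.norm_real]
  exact μ.abs_re_le_norm ha

theorem State.map_adj (μ : X.State) (x : X.toSubmodule) : μ.1 (X.adj x) = star (μ.1 x) := by
  have h1 := (μ.re_le_norm_and_im_eq_zero (a := x + X.adj x)
    (IsSelfAdjoint.add_star_self (x : 𝔄))).2
  have h2 := (μ.re_le_norm_and_im_eq_zero (a := Complex.I • (x - X.adj x)) (X.isSelfAdjoint_I_smul_sub_adj x)).2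
  simp only [map_add, map_smul, map_sub, Complex.add_im, smul_eq_mul, Complex.mul_im,
    Complex.I_re, Complex.I_im, Complex.sub_re, zero_mul, one_mul, zero_add] at h1 h2
  exact Complex.ext (by simp; linarith) (by simp; linarith)

/-- Split `x` into real and imaginary parts. The constant 2 is not sharp, but any bound uniform in
`μ` serves compactness and continuity. -/
theorem State.norm_le (μ : X.State) (x : X.toSubmodule) : ‖μ.1 x‖ ≤ 2 * ‖(x : 𝔄)‖ := by
  have h1 := μ.norm_le_of_isSelfAdjoint (a := x + X.adj x)
    (IsSelfAdjoint.add_star_self (x : 𝔄))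
  have h2 := μ.norm_le_of_isSelfAdjoint (a := Complex.I • (x - X.adj x)) (X.isSelfAdjoint_I_smul_sub_adj x)
  have n1 : ‖((x + X.adj x : X.toSubmodule) : 𝔄)‖ ≤ 2 * ‖(x : 𝔄)‖ := by
    refine (norm_add_le (x : 𝔄) (star (x : 𝔄))).trans ?_
    rw [norm_star]; linarith
  have n2 : ‖((Complex.I • (x - X.adj x) : X.toSubmodule) : 𝔄)‖ ≤ 2 * ‖(x : 𝔄)‖ := by
    rw [Submodule.coe_smul, norm_smul, Complex.norm_I, one_mul]
    refine (norm_sub_le (x : 𝔄) (star (x : 𝔄))).trans ?_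
    rw [norm_star]; linarith
  rw [map_smul, norm_smul, Complex.norm_I, one_mul, map_sub] at h2
  rw [map_add] at h1
  have h3 : (2 : ℂ) * μ.1 x = (μ.1 x + μ.1 (X.adj x)) + (μ.1 x - μ.1 (X.adj x)) := by ring
  have h4 := norm_add_le (μ.1 x + μ.1 (X.adj x)) (μ.1 x - μ.1 (X.adj x))
  rw [← h3, norm_mul, Complex.norm_two] at h4
  linarith

instance State.instCompactSpace : CompactSpace X.State := by
  have hind : IsInducing fun (μ : X.State) (x : X.toSubmodule) => μ.1 x := ⟨rfl⟩
  rw [← isCompact_univ_iff, hind.isCompact_iff, Set.image_univ]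
  -- As in Banach–Alaoglu: linearity, positivity and unitality are closed conditions inside a
  -- product of discs.
  refine (isCompact_univ_pi fun x : X.toSubmodule =>
    isCompact_closedBall (0 : ℂ) (2 * ‖(x : 𝔄)‖)).of_isClosed_subset ?_ ?_
  · have hr : Set.range (fun (μ : X.State) (x : X.toSubmodule) => μ.1 x) =
        Set.range ((↑) : (X.toSubmodule →ₗ[ℂ] ℂ) → X.toSubmodule → ℂ) ∩
          ((⋂ x : X.toSubmodule, ⋂ _ : 0 ≤ (x : 𝔄), {f | 0 ≤ (f x).re ∧ (f x).im = 0}) ∩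
            {f | f X.unit = 1}) := by
      ext f
      simp only [Set.mem_range, Set.mem_inter_iff, Set.mem_iInter, Set.mem_ofPred_eq]
      constructor
      · rintro ⟨μ, rfl⟩
        exact ⟨⟨μ.1, rfl⟩, μ.2.1, μ.2.2⟩
      · rintro ⟨⟨g, rfl⟩, h1, h2⟩
        exact ⟨⟨g, h1, h2⟩, rfl⟩
    rw [hr]
    refine (LinearMap.isClosed_range_coe _ _ _).inter (IsClosed.inter ?_ ?_)
    · refine isClosed_iInter fun x => isClosed_iInter fun _ => IsClosed.and ?_ ?_
      · exact isClosed_le continuous_const (Complex.continuous_re.comp (continuous_apply x))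
      · exact isClosed_eq (Complex.continuous_im.comp (continuous_apply x)) continuous_const
    · exact isClosed_eq (continuous_apply _) continuous_const
  · rintro _ ⟨μ, rfl⟩ x -
    simpa using μ.norm_le x

/-- A functional on a real space `V` embedded in `X`, whose value at a preimage `e` of the unit
is `1` and which is positive on elements with positive real part, is the restriction of a state. -/
theorem State.exists_extension {V : Type*} [AddCommGroup V] [Module ℝ V]
    (j : V →ₗ[ℝ] X.toSubmodule) (hj : Function.Injective j) (e : V) (he : j e = X.unit)
    (f : V →ₗ[ℝ] ℝ) (hf : ∀ v, 0 ≤ (j v : 𝔄) + star (j v : 𝔄) → 0 ≤ f v) (hfe : f e = 1) :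
    ∃ μ : X.State, ∀ v, (μ.1 (j v)).re = f v := by
  -- The cone of elements with positive real part lives on all of `X` as a real space, so the
  -- extension theorem applies without passing to the self-adjoint part.
  let s : PointedCone ℝ X.toSubmodule :=
    { carrier := {x | 0 ≤ (x : 𝔄) + star (x : 𝔄)}
      add_mem' := fun {x y} hx hy => by
        have := add_nonneg (Set.mem_ofPred.1 hx) (Set.mem_ofPred.1 hy)
        simp only [Set.mem_ofPred_eq, Submodule.coe_add, star_add]
        rwa [add_add_add_comm] at this
      zero_mem' := by simp
      smul_mem' := fun c x hx => by
        have := smul_nonneg c.2 (Set.mem_ofPred.1 hx)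
        have h2 : ((c • x : X.toSubmodule) : 𝔄) = (c : ℝ) • (x : 𝔄) := rfl
        rw [smul_add] at this
        simp only [Set.mem_ofPred_eq, h2, star_smul, star_trivial]
        exact this }
  have hs : ∀ x : X.toSubmodule, x ∈ s ↔ 0 ≤ (x : 𝔄) + star (x : 𝔄) := fun _ => Iff.rfl
  let eq := LinearEquiv.ofInjective j hj
  let F : X.toSubmodule →ₗ.[ℝ] ℝ := ⟨LinearMap.range j, f ∘ₗ eq.symm.toLinearMap⟩
  have hF : ∀ v, F ⟨j v, LinearMap.mem_range_self j v⟩ = f v := fun v => by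
    change f (eq.symm (eq v)) = f v
    rw [LinearEquiv.symm_apply_apply]
  obtain ⟨g, hgF, hgs⟩ := riesz_extension s F
    (by
      rintro ⟨_, v, rfl⟩ hx
      rw [hF]
      exact hf v hx)
    (by
      intro y
      -- A large multiple of the unit moves `y` into the cone, as the extension theorem requires.
      refine ⟨⟨j (‖(y : 𝔄) + star (y : 𝔄)‖ • e), LinearMap.mem_range_self j _⟩, ?_⟩
      rw [hs]
      have h := (IsSelfAdjoint.add_star_self (y : 𝔄)).neg_algebraMap_norm_le_self
      rw [Algebra.algebraMap_eq_smul_one, neg_le_iff_add_nonneg] at h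
      have h1 : (0 : 𝔄) ≤ ‖(y : 𝔄) + star (y : 𝔄)‖ • 1 :=
        smul_nonneg (norm_nonneg _) zero_le_one
      have h2 : ((j (‖(y : 𝔄) + star (y : 𝔄)‖ • e) : X.toSubmodule) : 𝔄) =
          ‖(y : 𝔄) + star (y : 𝔄)‖ • (1 : 𝔄) := by
        rw [map_smul, he]; rfl
      rw [Submodule.coe_add, h2]
      refine (add_nonneg h1 h).trans_eq ?_
      simp only [star_add, star_smul, star_one, star_trivial]
      abel)
  have hg : ∀ v, g (j v) = f v := fun v => (hgF ⟨j v, LinearMap.mem_range_self j v⟩).trans (hF v)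
  -- For self-adjoint x both ix and −ix have real part 0, so both lie in the cone. Hence the
  -- complexification g(x) − i g(ix) is real on self-adjoint elements.
  have hgI : ∀ x : X.toSubmodule, IsSelfAdjoint (x : 𝔄) → g (Complex.I • x) = 0 := fun x hx => by
    have key : ∀ y : X.toSubmodule, (y : 𝔄) + star (y : 𝔄) = 0 → 0 ≤ g y := fun y hy =>
      hgs y ((hs y).2 hy.ge)
    have h1 := key (Complex.I • x) (by simp [star_smul, hx.star_eq])
    have h2 := key (-(Complex.I • x)) (by simp [star_smul, hx.star_eq])
    rw [map_neg] at h2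
    linarith
  refine ⟨⟨Module.Dual.extendRCLike (𝕜 := ℂ) g, fun x hx => ?_, ?_⟩, fun v => ?_⟩
  · have hI := hgI x (IsSelfAdjoint.of_nonneg hx)
    have h0 : 0 ≤ g x := hgs x ((hs x).2 (add_nonneg hx (star_nonneg_iff.2 hx)))
    rw [Module.Dual.extendRCLike_apply]
    change 0 ≤ ((g x : ℂ) - Complex.I * (g (Complex.I • x) : ℂ)).re ∧
      ((g x : ℂ) - Complex.I * (g (Complex.I • x) : ℂ)).im = 0
    rw [hI]
    simpa using h0
  · rw [Module.Dual.extendRCLike_apply]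
    change (g X.unit : ℂ) - Complex.I * (g (Complex.I • X.unit) : ℂ) = 1
    rw [hgI X.unit (IsSelfAdjoint.one 𝔄), ← he, hg, hfe]
    simp
  · rw [Module.Dual.extendRCLike_apply]
    change ((g (j v) : ℂ) - Complex.I * (g (Complex.I • j v) : ℂ)).re = f v
    simp [hg]

end ConcreteOperatorSystem

/-! ### The sub-operator system is a compact quantum metric space -/

namespace ConcreteOperatorSystem

variable {𝔄 : Type*} [CStarAlgebra 𝔄] [PartialOrder 𝔄] [StarOrderedRing 𝔄]
  {X Y : ConcreteOperatorSystem 𝔄}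

/-- If the domain of `L` is dense and `L` vanishes only on scalars, the Monge-Kantorovich
distance induces a topology finer than the weak-* topology. -/
theorem State.mkPseudoEMetricSpace_le (L : ExtSeminorm X.toSubmodule)
    (h0 : ∀ x : X.toSubmodule, L x = 0 → ∃ c : ℂ, x = c • X.unit)
    (hd : Dense {x : X.toSubmodule | L x < ∞}) :
    (State.mkPseudoEMetricSpace L).toUniformSpace.toTopologicalSpace ≤
      (State.instTopologicalSpace X) := by
  let P : PseudoEMetricSpace X.State := State.mkPseudoEMetricSpace L
  refine continuous_iff_le_induced.1
    ((@continuous_pi_iff _ _ _ P.toUniformSpace.toTopologicalSpace _ _).2 fun x => ?_)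
  have hdom : ∀ y : X.toSubmodule, L y < ∞ → Continuous[P.toUniformSpace.toTopologicalSpace, _]
      fun μ : X.State => μ.1 y := by
    intro y hy
    by_cases hy0 : L y = 0
    · obtain ⟨c, rfl⟩ := h0 y hy0
      have : (fun μ : X.State => μ.1 (c • X.unit)) = fun _ => c := by
        funext μ
        rw [map_smul, μ.2.2, smul_eq_mul, mul_one]
      rw [this]
      exact @continuous_const _ _ P.toUniformSpace.toTopologicalSpace _ _
    · exact @continuous_of_enorm_sub_le _ _ P _ (L y) hy.ne _ fun μ ν =>
        State.enorm_sub_le_mul_mkDist L μ ν hy0 hy.ne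
  refine @continuous_of_uniform_approx_of_continuous _ _ P.toUniformSpace.toTopologicalSpace _ _
    fun u hu => ?_
  obtain ⟨δ, hδ, hu⟩ := Metric.mem_uniformity_dist.1 hu
  -- Half of `δ` compensates the factor 2 in `State.norm_le`; the estimate is uniform over all
  -- states.
  obtain ⟨y, hy, hxy⟩ := Metric.dense_iff.1 hd x (δ / 2) (half_pos hδ)
  refine ⟨fun μ => μ.1 y, hdom y hxy, fun μ => hu ?_⟩
  rw [dist_eq_norm, ← map_sub]
  refine (μ.norm_le _).trans_lt ?_
  rw [Metric.mem_ball, dist_comm, dist_eq_norm] at hy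
  change ‖((x - y : X.toSubmodule) : 𝔄)‖ < δ / 2 at hy
  linarith

theorem State.restrict_surjective (h : Y.toSubmodule ≤ X.toSubmodule) :
    Function.Surjective (State.restrict h) := by
  intro ν
  obtain ⟨μ, hμ⟩ := State.exists_extension (X := X)
    ((Submodule.inclusion h).restrictScalars ℝ) (Submodule.inclusion_injective h) Y.unit rfl
    (Complex.reLm ∘ₗ ν.1.restrictScalars ℝ) (fun y hy => by
      have h1 := (ν.2.1 (y + Y.adj y) hy).1
      rw [map_add, ν.map_adj] at h1
      simp only [Complex.add_re, Complex.star_def, Complex.conj_re] at h1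
      change 0 ≤ (ν.1 y).re
      linarith) (by
      change (ν.1 Y.unit).re = 1
      rw [ν.2.2, Complex.one_re])
  refine ⟨μ, Subtype.ext (LinearMap.ext fun y => Complex.ext (hμ y) ?_)⟩
  -- The extension only matches real parts; imaginary parts are read off at iy.
  have h2 : (μ.1 (Submodule.inclusion h (Complex.I • y))).re = (ν.1 (Complex.I • y)).re :=
    hμ (Complex.I • y)
  rw [map_smul, map_smul, map_smul] at h2
  change (μ.1 (Submodule.inclusion h y)).im = (ν.1 y).im
  simpa using h2

variable {L : ExtSeminorm X.toSubmodule} {hYX : Y.toSubmodule ≤ X.toSubmodule}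
  {K : ExtSeminorm Y.toSubmodule}

/-- Restriction of states is a surjection from the compact S(X) that does not increase distances, so
ρ_K inherits finiteness and compactness from ρ_L. The approximation hypothesis serves only to give
K(c·1) = 0. -/
theorem IsCQMS.of_approx (hL : X.IsCQMS L)
    (hK_dense : Dense {y : Y.toSubmodule | K y < ∞})
    (hK_adj : ∀ y : Y.toSubmodule, K y < ∞ → K (Y.adj y) < ∞)
    (hKL : ∀ y : Y.toSubmodule, K y < ∞ → K y = L (Submodule.inclusion hYX y))
    {ε : ℝ} (happrox : ∀ x : X.toSubmodule, ∃ y : Y.toSubmodule,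
      K y ≤ L x ∧ ‖(x : 𝔄) - (y : 𝔄)‖ₑ ≤ ENNReal.ofReal ε * L x) : Y.IsCQMS K := by
  have h0 : ∀ y : Y.toSubmodule, K y = 0 → ∃ c : ℂ, y = c • Y.unit := fun y hy => by
    obtain ⟨c, hc⟩ := (hL.eq_zero_iff (Submodule.inclusion hYX y)).1
      (by rw [← hKL y (by simp [hy]), hy])
    exact ⟨c, Subtype.ext (congrArg (fun x : X.toSubmodule => (x : 𝔄)) hc)⟩
  have hadj : ∀ y : Y.toSubmodule, K y < ∞ → K (Y.adj y) = K y := fun y hy => by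
    rw [hKL _ (hK_adj y hy), hKL y hy]
    exact hL.adj_eq (Submodule.inclusion hYX y)
  refine ⟨fun y => ⟨h0 y, ?_⟩, hK_dense, fun y => ?_, ?_⟩
  · rintro ⟨c, rfl⟩
    -- Scalars are not known in advance to lie in the domain of `K`. Since L(c·1) = 0, the
    -- approximant is c·1 itself.
    obtain ⟨y, hy, hxy⟩ := happrox (c • X.unit)
    rw [(hL.eq_zero_iff _).2 ⟨c, rfl⟩] at hy hxy
    have hcy : c • Y.unit = y := by
      rw [mul_zero, nonpos_iff_eq_zero, enorm_eq_zero, sub_eq_zero] at hxy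
      exact Subtype.ext hxy
    rw [hcy]
    exact nonpos_iff_eq_zero.1 hy
  · by_cases hy : K y < ∞
    · exact hadj y hy
    · by_cases hy' : K (Y.adj y) < ∞
      · have := hadj _ hy'
        rw [adj_adj] at this
        exact this.symm
      · rw [not_lt_top_iff.1 hy, not_lt_top_iff.1 hy']
  · refine metrisesTopology_of_surjective (State.mkPseudoEMetricSpace K)
      (fun μ ν => ?_) (State.mkPseudoEMetricSpace_le K h0 hK_dense) (State.restrict hYX) (fun μ => ?_)
      (State.restrict_surjective hYX)
    · obtain ⟨μ, rfl⟩ := State.restrict_surjective hYX μ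
      obtain ⟨ν, rfl⟩ := State.restrict_surjective hYX ν
      exact ne_top_of_le_ne_top (hL.metrises.ne_top μ ν) (State.mkDist_restrict_le hKL μ ν)
    · exact tendsto_of_tendsto_of_tendsto_of_le_of_le tendsto_const_nhds
        (hL.metrises.tendsto_zero μ) (fun _ => zero_le) fun ν => State.mkDist_restrict_le hKL ν μ

end ConcreteOperatorSystem

/-! ### Order unit spaces and their states -/

theorem IsOrderUnitSpace.prod {V W : Type*} [AddCommGroup V] [Module ℝ V] [PartialOrder V]
    [AddCommGroup W] [Module ℝ W] [PartialOrder W] {e : V} {e' : W}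
    (hV : IsOrderUnitSpace V e) (hW : IsOrderUnitSpace W e') (he : 0 ≤ e) (he' : 0 ≤ e') :
    IsOrderUnitSpace (V × W) (e, e') where
  add_le_add_right a b c h :=
    ⟨hV.add_le_add_right _ _ _ h.1, hW.add_le_add_right _ _ _ h.2⟩
  smul_nonneg t a ht ha := ⟨hV.smul_nonneg t _ ht ha.1, hW.smul_nonneg t _ ht ha.2⟩
  exists_le_smul a := by
    obtain ⟨s, hs⟩ := hV.exists_le_smul a.1
    obtain ⟨t, ht⟩ := hW.exists_le_smul a.2
    refine ⟨max s t, hs.trans ?_, ht.trans ?_⟩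
    · have h := hV.add_le_add_right _ _ (s • e)
        (hV.smul_nonneg _ e (sub_nonneg.2 (le_max_left s t)) he)
      rwa [zero_add, ← add_smul, sub_add_cancel] at h
    · have h := hW.add_le_add_right _ _ (t • e')
        (hW.smul_nonneg _ e' (sub_nonneg.2 (le_max_right s t)) he')
      rwa [zero_add, ← add_smul, sub_add_cancel] at h
  archimedean a h :=
    ⟨hV.archimedean _ fun t ht => (h t ht).1, hW.archimedean _ fun t ht => (h t ht).2⟩

namespace OrderUnitState

variable {V : Type*} [AddCommGroup V] [Module ℝ V] [PartialOrder V] {e : V}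

instance instT2Space : T2Space (OrderUnitState V e) :=
  T2Space.of_injective_continuous (f := fun (μ : OrderUnitState V e) (v : V) => μ.1 v)
    (fun _ _ h => Subtype.ext (LinearMap.ext fun v => congrFun h v)) continuous_induced_dom

theorem enorm_sub_le_mul_mkDist (M : Seminorm ℝ V) (μ ν : OrderUnitState V e) {v : V}
    (h0 : M v ≠ 0) : ‖μ.1 v - ν.1 v‖ₑ ≤ ENNReal.ofReal (M v) * mkDist M μ ν := by
  have hpos : 0 < M v := (apply_nonneg M v).lt_of_ne' h0
  have hle : M ((M v)⁻¹ • v) ≤ 1 := by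
    rw [map_smul_eq_mul, Real.norm_of_nonneg (inv_nonneg.2 hpos.le), inv_mul_cancel₀ h0]
  have h : ‖μ.1 ((M v)⁻¹ • v) - ν.1 ((M v)⁻¹ • v)‖ₑ ≤ mkDist M μ ν :=
    le_iSup₂ (f := fun (a : V) (_ : M a ≤ 1) => ‖μ.1 a - ν.1 a‖ₑ) _ hle
  rw [map_smul, map_smul, ← smul_sub, enorm_smul, ← ofReal_norm (_⁻¹ : ℝ),
    Real.norm_of_nonneg (inv_nonneg.2 hpos.le)] at h
  calc ‖μ.1 v - ν.1 v‖ₑ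
      = ENNReal.ofReal (M v) * (ENNReal.ofReal (M v)⁻¹ * ‖μ.1 v - ν.1 v‖ₑ) := by
        rw [← mul_assoc, ← ENNReal.ofReal_mul hpos.le, mul_inv_cancel₀ h0, ENNReal.ofReal_one,
          one_mul]
    _ ≤ _ := by gcongr

/-- If `M` vanishes only on multiples of the order unit, the Monge-Kantorovich distance induces
a topology finer than the weak-* topology. -/
theorem mkPseudoEMetricSpace_le (M : Seminorm ℝ V) (h0 : ∀ v : V, M v = 0 → ∃ t : ℝ, v = t • e) :
    (mkPseudoEMetricSpace M).toUniformSpace.toTopologicalSpace ≤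
      (instTopologicalSpace : TopologicalSpace (OrderUnitState V e)) := by
  let P : PseudoEMetricSpace (OrderUnitState V e) := mkPseudoEMetricSpace M
  refine continuous_iff_le_induced.1
    ((@continuous_pi_iff _ _ _ P.toUniformSpace.toTopologicalSpace _ _).2 fun v => ?_)
  by_cases hv0 : M v = 0
  · obtain ⟨c, rfl⟩ := h0 v hv0
    have : (fun μ : OrderUnitState V e => μ.1 (c • e)) = fun _ => c := by
      funext μ
      rw [map_smul, μ.2.2, smul_eq_mul, mul_one]
    rw [this]
    exact @continuous_const _ _ P.toUniformSpace.toTopologicalSpace _ _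
  · exact @continuous_of_enorm_sub_le _ _ P _ (ENNReal.ofReal (M v)) ENNReal.ofReal_ne_top _
      fun μ ν => enorm_sub_le_mul_mkDist M μ ν hv0

end OrderUnitState

/-! ### Order unit spaces inside an operator system; states of direct sums -/

namespace ConcreteOperatorSystem

variable {𝔄 : Type*} [CStarAlgebra 𝔄] [PartialOrder 𝔄]

/-- `j` realises the partially ordered real space `V` with distinguished element `e` as a space of
self-adjoint elements of the operator system `X`, with `e` corresponding to the unit. -/
structure IsOrderUnitEmbedding (X : ConcreteOperatorSystem 𝔄) {V : Type*} [AddCommGroup V]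
    [Module ℝ V] [PartialOrder V] (e : V) (j : V →ₗ[ℝ] X.toSubmodule) : Prop where
  le_iff : ∀ v w : V, v ≤ w ↔ (j v : 𝔄) ≤ (j w : 𝔄)
  isSelfAdjoint : ∀ v : V, IsSelfAdjoint (j v : 𝔄)
  map_unit : j e = X.unit

namespace IsOrderUnitEmbedding

variable {X : ConcreteOperatorSystem 𝔄}
  {V : Type*} [AddCommGroup V] [Module ℝ V] [PartialOrder V] {e : V} {j : V →ₗ[ℝ] X.toSubmodule}
  {W : Type*} [AddCommGroup W] [Module ℝ W] [PartialOrder W] {e' : W} {k : W →ₗ[ℝ] X.toSubmodule}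

theorem nonneg_iff (h : X.IsOrderUnitEmbedding e j) (v : V) : 0 ≤ v ↔ 0 ≤ (j v : 𝔄) := by
  rw [h.le_iff, map_zero]; rfl

theorem injective (h : X.IsOrderUnitEmbedding e j) : Function.Injective j := fun v w hvw =>
  le_antisymm ((h.le_iff v w).2 (by rw [hvw])) ((h.le_iff w v).2 (by rw [hvw]))

theorem coe_smul_unit (h : X.IsOrderUnitEmbedding e j) (t : ℝ) :
    ((j (t • e) : X.toSubmodule) : 𝔄) = t • (1 : 𝔄) := by
  rw [map_smul, h.map_unit]; rfl

/-- The order unit state given by the real part of a state of the ambient operator system. -/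
noncomputable def pullback (h : X.IsOrderUnitEmbedding e j) (μ : X.State) : OrderUnitState V e :=
  ⟨Complex.reLm ∘ₗ μ.1.restrictScalars ℝ ∘ₗ j,
    fun v hv => (μ.2.1 (j v) ((h.nonneg_iff v).1 hv)).1, by
      change (μ.1 (j e)).re = 1
      rw [h.map_unit, μ.2.2, Complex.one_re]⟩

theorem pullback_apply (h : X.IsOrderUnitEmbedding e j) (μ : X.State) (v : V) :
    (h.pullback μ).1 v = (μ.1 (j v)).re := rfl

/-- The convex combination `t μ ⊕ (1 - t) ν` as an order unit state of a direct sum. -/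
noncomputable def mixedState (h : X.IsOrderUnitEmbedding e j) (h' : X.IsOrderUnitEmbedding e' k)
    (z : X.State × X.State × Set.Icc (0 : ℝ) 1) : OrderUnitState (V × W) (e, e') :=
  ⟨(z.2.2 : ℝ) • (h.pullback z.1).1 ∘ₗ LinearMap.fst ℝ V W +
      (1 - (z.2.2 : ℝ)) • (h'.pullback z.2.1).1 ∘ₗ LinearMap.snd ℝ V W,
    fun c hc => add_nonneg (mul_nonneg z.2.2.2.1 ((h.pullback z.1).2.1 c.1 hc.1))
      (mul_nonneg (sub_nonneg.2 z.2.2.2.2) ((h'.pullback z.2.1).2.1 c.2 hc.2)), by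
    change (z.2.2 : ℝ) * (h.pullback z.1).1 e + (1 - (z.2.2 : ℝ)) * (h'.pullback z.2.1).1 e' = 1
    rw [(h.pullback z.1).2.2, (h'.pullback z.2.1).2.2]
    ring⟩

theorem mixedState_apply (h : X.IsOrderUnitEmbedding e j) (h' : X.IsOrderUnitEmbedding e' k)
    (z : X.State × X.State × Set.Icc (0 : ℝ) 1) (c : V × W) :
    (h.mixedState h' z).1 c =
      (z.2.2 : ℝ) * (z.1.1 (j c.1)).re + (1 - (z.2.2 : ℝ)) * (z.2.1.1 (k c.2)).re := rfl

variable [StarOrderedRing 𝔄]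

theorem unit_nonneg (h : X.IsOrderUnitEmbedding e j) : 0 ≤ e := by
  rw [h.nonneg_iff, h.map_unit]
  exact zero_le_one

theorem le_norm_smul (h : X.IsOrderUnitEmbedding e j) (v : V) : v ≤ ‖(j v : 𝔄)‖ • e := by
  rw [h.le_iff, h.coe_smul_unit, ← Algebra.algebraMap_eq_smul_one]
  exact (h.isSelfAdjoint v).le_algebraMap_norm_self

theorem isOrderUnitSpace (h : X.IsOrderUnitEmbedding e j) : IsOrderUnitSpace V e where
  add_le_add_right a b c hab := by
    rw [h.le_iff] at hab ⊢
    simpa using hab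
  smul_nonneg t a ht ha := by
    rw [h.nonneg_iff] at ha ⊢
    rw [map_smul]
    exact smul_nonneg ht ha
  exists_le_smul a := ⟨_, h.le_norm_smul a⟩
  archimedean a ha := by
    rw [h.le_iff, map_zero]
    have hlim : Tendsto (fun t : ℝ => t • (1 : 𝔄)) (𝓝[>] 0) (𝓝 ((0 : ℝ) • (1 : 𝔄))) :=
      ((continuous_id.smul continuous_const).tendsto 0).mono_left nhdsWithin_le_nhds
    rw [zero_smul] at hlim
    refine ge_of_tendsto hlim ?_
    filter_upwards [self_mem_nhdsWithin] with t ht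
    have := (h.le_iff _ _).1 (ha t ht)
    rwa [h.coe_smul_unit] at this

theorem nonneg_of_nonneg_add_star (h : X.IsOrderUnitEmbedding e j) {v : V}
    (hv : 0 ≤ (j v : 𝔄) + star (j v : 𝔄)) : 0 ≤ v := by
  rw [(h.isSelfAdjoint v).star_eq, ← two_smul ℝ] at hv
  rw [h.nonneg_iff]
  have := smul_nonneg (inv_nonneg.2 (zero_le_two (α := ℝ))) hv
  rwa [inv_smul_smul₀ two_ne_zero] at this

theorem pullback_surjective (h : X.IsOrderUnitEmbedding e j) :
    Function.Surjective h.pullback := by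
  intro σ
  obtain ⟨μ, hμ⟩ := State.exists_extension j h.injective e h.map_unit σ.1
    (fun v hv => σ.2.1 v (h.nonneg_of_nonneg_add_star hv)) σ.2.2
  exact ⟨μ, Subtype.ext (LinearMap.ext hμ)⟩

/-- A positive functional is a multiple of the pullback of a state. -/
theorem exists_state_of_nonneg [Nonempty X.State] (h : X.IsOrderUnitEmbedding e j)
    (f : V →ₗ[ℝ] ℝ) (hf : ∀ v, 0 ≤ v → 0 ≤ f v) :
    ∃ μ : X.State, ∀ v, f e * (μ.1 (j v)).re = f v := by
  have hbound : ∀ v, f v ≤ ‖(j v : 𝔄)‖ * f e := fun v => by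
    have hle : 0 ≤ ‖(j v : 𝔄)‖ • e - v := by
      have := h.isOrderUnitSpace.add_le_add_right _ _ (-v) (h.le_norm_smul v)
      rwa [add_neg_cancel, ← sub_eq_add_neg] at this
    have := hf _ hle
    rw [map_sub, map_smul, smul_eq_mul] at this
    linarith
  -- By `hbound`, f(e) = 0 forces f = 0, and then any state will do; this is where nonemptiness
  -- enters.
  by_cases he : f e = 0
  · refine ⟨Classical.arbitrary _, fun v => ?_⟩
    have h1 := hbound v
    have h2 := hbound (-v)
    rw [map_neg] at h2
    rw [he, mul_zero] at h1 h2
    rw [he, zero_mul]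
    linarith
  · have hpos : 0 < f e := (hf e h.unit_nonneg).lt_of_ne' he
    obtain ⟨μ, hμ⟩ := h.pullback_surjective ⟨(f e)⁻¹ • f,
      fun v hv => mul_nonneg (inv_nonneg.2 hpos.le) (hf v hv), inv_mul_cancel₀ he⟩
    refine ⟨μ, fun v => ?_⟩
    rw [← h.pullback_apply, hμ]
    change f e * ((f e)⁻¹ * f v) = f v
    rw [mul_inv_cancel_left₀ he]

/-- The state space of an operator system in a nontrivial algebra is nonempty. -/
theorem _root_.ConcreteOperatorSystem.State.nonempty [Nontrivial 𝔄] : Nonempty X.State := by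
  have h : X.IsOrderUnitEmbedding (1 : ℝ) (LinearMap.toSpanSingleton ℝ X.toSubmodule X.unit) :=
    ⟨fun s t => (smul_le_smul_iff_of_pos_right (zero_lt_one' 𝔄)).symm,
      fun t => (IsSelfAdjoint.all t).smul (IsSelfAdjoint.one 𝔄), one_smul ℝ X.unit⟩
  obtain ⟨μ, -⟩ := h.pullback_surjective ⟨LinearMap.id, fun _ ht => ht, rfl⟩
  exact ⟨μ⟩

/-- A state of the sum restricts to positive functionals on the summands, of masses t and 1 − t, and
each is its mass times the pullback of a state. -/
theorem mixedState_surjective (h : X.IsOrderUnitEmbedding e j)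
    (h' : X.IsOrderUnitEmbedding e' k) : Function.Surjective (h.mixedState h') := by
  intro σ
  have : Nonempty X.State := by
    -- In the zero algebra (e, e') = 0, which contradicts σ(e, e') = 1.
    cases subsingleton_or_nontrivial 𝔄
    · have h1 : (e, e') = 0 := Prod.ext (h.injective (Subsingleton.elim _ _))
        (h'.injective (Subsingleton.elim _ _))
      have h2 := (congrArg σ.1 h1).symm.trans σ.2.2
      rw [map_zero] at h2
      exact absurd h2 zero_ne_one
    · exact State.nonempty
  have hl : ∀ v, 0 ≤ v → 0 ≤ (σ.1 ∘ₗ LinearMap.inl ℝ V W) v := fun v hv => σ.2.1 _ ⟨hv, le_rfl⟩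
  have hr : ∀ w, 0 ≤ w → 0 ≤ (σ.1 ∘ₗ LinearMap.inr ℝ V W) w := fun w hw => σ.2.1 _ ⟨le_rfl, hw⟩
  obtain ⟨μ, hμ⟩ := h.exists_state_of_nonneg _ hl
  obtain ⟨ν, hν⟩ := h'.exists_state_of_nonneg _ hr
  have hadd : ∀ c : V × W, (σ.1 ∘ₗ LinearMap.inl ℝ V W) c.1 + (σ.1 ∘ₗ LinearMap.inr ℝ V W) c.2 =
      σ.1 c := fun c => by
    simp [← map_add]
  have h1 := (hadd (e, e')).trans σ.2.2
  have hle := hr e' h'.unit_nonneg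
  refine ⟨⟨μ, ν, ⟨(σ.1 ∘ₗ LinearMap.inl ℝ V W) e, hl e h.unit_nonneg, ?_⟩⟩,
    Subtype.ext (LinearMap.ext fun c => ?_)⟩
  · simp only at h1
    linarith
  · rw [mixedState_apply, ← hadd c, ← hμ c.1, ← hν c.2]
    congr 2
    simp only at h1 ⊢
    linarith

end IsOrderUnitEmbedding

end ConcreteOperatorSystem

/-! ### The bridge seminorm -/

namespace ConcreteOperatorSystem

variable {𝔄 : Type*} [CStarAlgebra 𝔄] {X Y : ConcreteOperatorSystem 𝔄}

section Bridge

variable {V : Type*} [AddCommGroup V] [Module ℝ V]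
  {W : Type*} [AddCommGroup W] [Module ℝ W]

/-- The seminorm `(v, w) ↦ max {p v, q w, ‖v - w‖ / ε}` on the direct sum of two real spaces that
are mapped to the operator system `X`. -/
noncomputable def bridgeSeminorm (p : Seminorm ℝ V) (q : Seminorm ℝ W)
    (j : V →ₗ[ℝ] X.toSubmodule) (k : W →ₗ[ℝ] X.toSubmodule) (ε : ℝ) : Seminorm ℝ (V × W) :=
  p.comp (LinearMap.fst ℝ V W) ⊔ q.comp (LinearMap.snd ℝ V W) ⊔
    (normSeminorm ℝ X.toSubmodule).comp
      (ε⁻¹ • (j ∘ₗ LinearMap.fst ℝ V W - k ∘ₗ LinearMap.snd ℝ V W))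

variable {p : Seminorm ℝ V} {q : Seminorm ℝ W}
  {j : V →ₗ[ℝ] X.toSubmodule} {k : W →ₗ[ℝ] X.toSubmodule} {ε : ℝ}

theorem bridgeSeminorm_le_iff (hε : 0 < ε) {r : ℝ} {c : V × W} :
    bridgeSeminorm p q j k ε c ≤ r ↔
      p c.1 ≤ r ∧ q c.2 ≤ r ∧ ‖((j c.1 - k c.2 : X.toSubmodule) : 𝔄)‖ ≤ ε * r := by
  have h : bridgeSeminorm p q j k ε c =
      max (max (p c.1) (q c.2)) ‖ε⁻¹ • (j c.1 - k c.2)‖ := rfl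
  rw [h, max_le_iff, max_le_iff, and_assoc, norm_smul, Real.norm_of_nonneg (inv_nonneg.2 hε.le),
    inv_mul_le_iff₀ hε]
  rfl

theorem bridgeSeminorm_self_le (hε : 0 < ε) (c : V × W) :
    p c.1 ≤ bridgeSeminorm p q j k ε c ∧ q c.2 ≤ bridgeSeminorm p q j k ε c :=
  have h := (bridgeSeminorm_le_iff (p := p) (q := q) (j := j) (k := k) hε).1 (le_refl _)
  ⟨h.1, h.2.1⟩

variable [PartialOrder 𝔄] [PartialOrder V] [PartialOrder W] {e : V} {e' : W}

/-- The norm term forces the scalars in the two summands to coincide. -/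
theorem bridgeSeminorm_eq_zero_iff (hj : X.IsOrderUnitEmbedding e j)
    (hk : X.IsOrderUnitEmbedding e' k) (hε : 0 < ε)
    (hp : ∀ v, p v = 0 ↔ ∃ t : ℝ, v = t • e) (hq : ∀ w, q w = 0 ↔ ∃ t : ℝ, w = t • e')
    (c : V × W) : bridgeSeminorm p q j k ε c = 0 ↔ ∃ t : ℝ, c = t • (e, e') := by
  rw [← (apply_nonneg (bridgeSeminorm p q j k ε) c).ge_iff_eq', bridgeSeminorm_le_iff hε,
    mul_zero, norm_le_zero_iff, Submodule.coe_eq_zero, sub_eq_zero,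
    (apply_nonneg p _).ge_iff_eq', (apply_nonneg q _).ge_iff_eq', hp, hq]
  constructor
  · rintro ⟨⟨t, ht⟩, -, h⟩
    refine ⟨t, Prod.ext ht (hk.injective ?_)⟩
    rw [← h, ht, Prod.smul_snd, map_smul, map_smul, hj.map_unit, hk.map_unit]
  · rintro ⟨t, rfl⟩
    refine ⟨⟨t, rfl⟩, ⟨t, rfl⟩, ?_⟩
    rw [Prod.smul_fst, Prod.smul_snd, map_smul, map_smul, hj.map_unit, hk.map_unit]

variable {L : ExtSeminorm X.toSubmodule}

theorem State.abs_re_sub_le_mkDist (hL : X.IsCQMS L) (μ ν : X.State) {x : X.toSubmodule}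
    (hx : L x ≤ 1) : |(μ.1 x).re - (ν.1 x).re| ≤ (State.mkDist L μ ν).toReal := by
  have h := ENNReal.toReal_mono (hL.metrises.ne_top μ ν) (State.enorm_sub_le_mkDist L μ ν hx)
  rw [toReal_enorm] at h
  rw [← Complex.sub_re]
  exact (Complex.abs_re_le_norm _).trans h

variable [StarOrderedRing 𝔄]

/-- The two pullbacks of a state differ by at most `ε` on elements of seminorm at most `1`. -/
theorem State.abs_re_sub_le_of_bridgeSeminorm_le (hj : X.IsOrderUnitEmbedding e j)
    (hk : X.IsOrderUnitEmbedding e' k) (hε : 0 < ε) (μ : X.State) {c : V × W}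
    (hc : bridgeSeminorm p q j k ε c ≤ 1) : |(μ.1 (j c.1)).re - (μ.1 (k c.2)).re| ≤ ε := by
  have h := ((bridgeSeminorm_le_iff hε).1 hc).2.2
  rw [mul_one] at h
  refine le_trans ?_ h
  rw [← Complex.sub_re, ← map_sub]
  exact μ.abs_re_le_norm ((hj.isSelfAdjoint _).sub (hk.isSelfAdjoint _))

/-- The bound is finite and tends to 0 as z' → z, which gives both the finiteness of ρ_M and the
continuity of `mixedState`. -/
theorem mkDist_mixedState_le (hL : X.IsCQMS L) (hj : X.IsOrderUnitEmbedding e j)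
    (hk : X.IsOrderUnitEmbedding e' k) (hε : 0 < ε)
    (hp : ∀ v, p v ≤ 1 → L (j v) ≤ 1) (hq : ∀ w, q w ≤ 1 → L (k w) ≤ 1)
    (z z' : X.State × X.State × Set.Icc (0 : ℝ) 1) :
    OrderUnitState.mkDist (bridgeSeminorm p q j k ε) (hj.mixedState hk z') (hj.mixedState hk z) ≤
      ENNReal.ofReal (|(z'.2.2 : ℝ) - z.2.2| * ((State.mkDist L z.1 z.2.1).toReal + ε) +
        (State.mkDist L z'.1 z.1).toReal + (State.mkDist L z'.2.1 z.2.1).toReal) := by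
  refine iSup₂_le fun c hc => ?_
  obtain ⟨hc1, hc2, -⟩ := (bridgeSeminorm_le_iff hε).1 hc
  rw [← ofReal_norm]
  refine ENNReal.ofReal_le_ofReal ?_
  rw [Real.norm_eq_abs, hj.mixedState_apply, hj.mixedState_apply]
  obtain ⟨μ, ν, t, ht0, ht1⟩ := z
  obtain ⟨μ', ν', t', ht0', ht1'⟩ := z'
  have h1 := State.abs_re_sub_le_mkDist hL μ ν (hp _ hc1)
  have h2 := State.abs_re_sub_le_mkDist hL μ' μ (hp _ hc1)
  have h3 := State.abs_re_sub_le_mkDist hL ν' ν (hq _ hc2)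
  have h4 := State.abs_re_sub_le_of_bridgeSeminorm_le hj hk hε ν hc
  simp only
  set a := (μ.1 (j c.1)).re
  set a' := (μ'.1 (j c.1)).re
  set b := (ν.1 (k c.2)).re
  set b' := (ν'.1 (k c.2)).re
  set d := (ν.1 (j c.1)).re
  -- The values of μ on c.1 and of ν on c.2 are compared through d, the value of ν on c.1.
  have hab : |a - b| ≤ (State.mkDist L μ ν).toReal + ε := by
    rw [← sub_add_sub_cancel a d b]
    exact (abs_add_le _ _).trans (add_le_add h1 h4)
  calc |t' * a' + (1 - t') * b' - (t * a + (1 - t) * b)|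
      = |(t' - t) * (a - b) + t' * (a' - a) + (1 - t') * (b' - b)| := by congr 1; ring
    _ ≤ |t' - t| * |a - b| + t' * |a' - a| + (1 - t') * |b' - b| := by
        refine (abs_add_three _ _ _).trans_eq ?_
        rw [abs_mul, abs_mul, abs_mul, abs_of_nonneg ht0', abs_of_nonneg (sub_nonneg.2 ht1')]
    _ ≤ |t' - t| * ((State.mkDist L μ ν).toReal + ε) + 1 * (State.mkDist L μ' μ).toReal +
          1 * (State.mkDist L ν' ν).toReal := by
        gcongr
        linarith
    _ = _ := by ring

theorem isOrderUnitCQMS_bridgeSeminorm (hL : X.IsCQMS L) (hj : X.IsOrderUnitEmbedding e j)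
    (hk : X.IsOrderUnitEmbedding e' k) (hε : 0 < ε)
    (hp : ∀ v, p v ≤ 1 → L (j v) ≤ 1) (hq : ∀ w, q w ≤ 1 → L (k w) ≤ 1)
    (hp0 : ∀ v, p v = 0 ↔ ∃ t : ℝ, v = t • e) (hq0 : ∀ w, q w = 0 ↔ ∃ t : ℝ, w = t • e') :
    IsOrderUnitCQMS (e, e') (bridgeSeminorm p q j k ε) := by
  have h0 := bridgeSeminorm_eq_zero_iff (p := p) (q := q) hj hk hε hp0 hq0
  refine ⟨hj.isOrderUnitSpace.prod hk.isOrderUnitSpace hj.unit_nonneg hk.unit_nonneg, h0, ?_⟩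
  have hsurj := hj.mixedState_surjective hk
  refine metrisesTopology_of_surjective
    (OrderUnitState.mkPseudoEMetricSpace (bridgeSeminorm p q j k ε)) (fun σ τ => ?_)
    (OrderUnitState.mkPseudoEMetricSpace_le _ fun c => (h0 c).1) (hj.mixedState hk) (fun z => ?_)
    hsurj
  · obtain ⟨z', rfl⟩ := hsurj σ
    obtain ⟨z, rfl⟩ := hsurj τ
    exact ne_top_of_le_ne_top ENNReal.ofReal_ne_top (mkDist_mixedState_le hL hj hk hε hp hq z z')
  · refine tendsto_of_tendsto_of_tendsto_of_le_of_le tendsto_const_nhds ?_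
      (fun _ => zero_le) fun z' => mkDist_mixedState_le hL hj hk hε hp hq z z'
    have hdist : ∀ μ : X.State,
        Tendsto (fun ν => (State.mkDist L ν μ).toReal) (𝓝 μ) (𝓝 0) := fun μ =>
      (ENNReal.tendsto_toReal ENNReal.zero_ne_top).comp (hL.metrises.tendsto_zero μ)
    have ht : Tendsto (fun z' : X.State × X.State × Set.Icc (0 : ℝ) 1 =>
        |(z'.2.2 : ℝ) - z.2.2| * ((State.mkDist L z.1 z.2.1).toReal + ε)) (𝓝 z) (𝓝 0) := by
      have : Continuous fun z' : X.State × X.State × Set.Icc (0 : ℝ) 1 =>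
        |(z'.2.2 : ℝ) - z.2.2| * ((State.mkDist L z.1 z.2.1).toReal + ε) := by fun_prop
      simpa using this.tendsto z
    have h := (ht.add ((hdist z.1).comp (continuous_fst.tendsto z))).add
      ((hdist z.2.1).comp ((continuous_fst.comp continuous_snd).tendsto z))
    have h' := (ENNReal.continuous_ofReal.tendsto _).comp h
    simpa [Function.comp_def] using h'

/-- Both state spaces are images of S(X), so the two pullbacks of a common state are partners at
distance at most `ε`. -/
theorem stateHausdorffDist_bridgeSeminorm_le (hj : X.IsOrderUnitEmbedding e j)
    (hk : X.IsOrderUnitEmbedding e' k) (hε : 0 < ε) :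
    stateHausdorffDist e e' (bridgeSeminorm p q j k ε) ≤ ENNReal.ofReal ε := by
  have key : ∀ μ : X.State, OrderUnitState.mkDist (bridgeSeminorm p q j k ε)
      (OrderUnitState.inl (hj.pullback μ)) (OrderUnitState.inr (hk.pullback μ)) ≤
        ENNReal.ofReal ε := fun μ => by
    refine iSup₂_le fun c hc => ?_
    rw [← ofReal_norm]
    exact ENNReal.ofReal_le_ofReal (State.abs_re_sub_le_of_bridgeSeminorm_le hj hk hε μ hc)
  let P : PseudoEMetricSpace (OrderUnitState (V × W) (e, e')) :=
    OrderUnitState.mkPseudoEMetricSpace (bridgeSeminorm p q j k ε)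
  refine @Metric.hausdorffEDist_le_of_mem_edist _ P _ _ _ ?_ ?_
  · rintro _ ⟨σ, rfl⟩
    obtain ⟨μ, rfl⟩ := hj.pullback_surjective σ
    exact ⟨_, ⟨hk.pullback μ, rfl⟩, key μ⟩
  · rintro _ ⟨σ, rfl⟩
    obtain ⟨μ, rfl⟩ := hk.pullback_surjective σ
    exact ⟨_, ⟨hj.pullback μ, rfl⟩, (P.edist_comm _ _).trans_le (key μ)⟩

end Bridge

/-! ### Self-adjoint elements of finite seminorm -/

variable {L : ExtSeminorm X.toSubmodule} {K : ExtSeminorm Y.toSubmodule}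

theorem lipSeminorm_apply (a : X.lipSelfAdjoint L) : X.lipSeminorm L a = (L a.1).toReal := rfl

theorem le_one_of_lipSeminorm_le_one (a : X.lipSelfAdjoint L) (ha : X.lipSeminorm L a ≤ 1) :
    L a.1 ≤ 1 := by
  rw [← ENNReal.toReal_le_toReal a.2.2.ne ENNReal.one_ne_top]
  exact ha

variable [PartialOrder 𝔄]

theorem isOrderUnitEmbedding_subtype (hL : X.IsCQMS L) :
    X.IsOrderUnitEmbedding (lipUnit hL) (X.lipSelfAdjoint L).subtype :=
  ⟨fun _ _ => Iff.rfl, fun v => v.2.1, rfl⟩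

theorem isOrderUnitEmbedding_inclusion (hYX : Y.toSubmodule ≤ X.toSubmodule) (hK : Y.IsCQMS K) :
    X.IsOrderUnitEmbedding (lipUnit hK)
      ((Submodule.inclusion hYX).restrictScalars ℝ ∘ₗ (Y.lipSelfAdjoint K).subtype) :=
  ⟨fun _ _ => Iff.rfl, fun v => v.2.1, rfl⟩

theorem IsCQMS.lipSeminorm_eq_zero_iff (hL : X.IsCQMS L) (a : X.lipSelfAdjoint L) :
    X.lipSeminorm L a = 0 ↔ ∃ t : ℝ, a = t • lipUnit hL := by
  rw [lipSeminorm_apply, ENNReal.toReal_eq_zero_iff, or_iff_left a.2.2.ne, hL.eq_zero_iff]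
  constructor
  · rintro ⟨c, hc⟩
    refine ⟨c.re, Subtype.ext (Subtype.ext ?_)⟩
    have h1 : ((a : X.toSubmodule) : 𝔄) = c • (1 : 𝔄) := 
      congrArg (fun x : X.toSubmodule => (x : 𝔄)) hc
    have h2 : star ((a : X.toSubmodule) : 𝔄) = star c • (1 : 𝔄) := by
      rw [h1, star_smul, star_one]
    rw [a.2.1.star_eq] at h2
    change ((a : X.toSubmodule) : 𝔄) = c.re • (1 : 𝔄)
    -- Adding a = c·1 and a = c̄·1 avoids deducing that c is real, which fails when 1 = 0.
    have h3 : ((a : X.toSubmodule) : 𝔄) + (a : X.toSubmodule) = (2 * c.re) • (1 : 𝔄) := by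
      nth_rewrite 1 [h1]
      rw [h2, ← add_smul, ← Complex.coe_smul, Complex.star_def, Complex.add_conj]
    rw [← two_smul ℝ, mul_smul] at h3
    exact smul_right_injective 𝔄 (two_ne_zero (α := ℝ)) h3
  · rintro ⟨t, rfl⟩
    exact ⟨t, (Complex.coe_smul t X.unit).symm⟩

/-- The approximation of a self-adjoint element can be chosen self-adjoint. -/
theorem IsCQMS.exists_selfAdjoint_approx (hK : Y.IsCQMS K) {ε : ℝ} {x : 𝔄} (hx : IsSelfAdjoint x)
    {r : ℝ≥0∞} (hr : r < ∞) {y : Y.toSubmodule} (hKy : K y ≤ r)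
    (hxy : ‖x - (y : 𝔄)‖ₑ ≤ ENNReal.ofReal ε * r) :
    ∃ b : Y.lipSelfAdjoint K, K b.1 ≤ r ∧ ‖x - ((b : Y.toSubmodule) : 𝔄)‖ₑ ≤
      ENNReal.ofReal ε * r := by
  let b : Y.toSubmodule := ((2⁻¹ : ℝ) : ℂ) • (y + Y.adj y)
  have hhalf : ENNReal.ofReal 2⁻¹ = 2⁻¹ := by
    rw [ENNReal.ofReal_inv_of_pos two_pos, ENNReal.ofReal_ofNat]
  have hb : K b ≤ r := by
    rw [K.ofReal_smul (by norm_num), hhalf]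
    calc 2⁻¹ * K (y + Y.adj y) ≤ 2⁻¹ * (r + r) := by
          gcongr
          refine (K.add_le' _ _).trans (add_le_add hKy ?_)
          rw [hK.adj_eq]
          exact hKy
      _ = r := by rw [← two_mul, ← mul_assoc, ENNReal.inv_mul_cancel two_ne_zero (by simp), one_mul]
  have hbc : (b : 𝔄) = (2⁻¹ : ℝ) • ((y : 𝔄) + star (y : 𝔄)) := Complex.coe_smul _ _
  refine ⟨⟨b, ?_, hb.trans_lt hr⟩, hb, ?_⟩
  · rw [hbc]
    exact (IsSelfAdjoint.all (2⁻¹ : ℝ)).smul (IsSelfAdjoint.add_star_self (y : 𝔄))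
  -- Since x is its own real part, x − b is the real part of x − y, whose norm is no larger.
  · have h1 : x - (b : 𝔄) = (2⁻¹ : ℝ) • ((x - y) + star (x - (y : 𝔄))) := by
      rw [hbc, star_sub, hx.star_eq]
      module
    change ‖x - (b : 𝔄)‖ₑ ≤ _
    refine le_trans ?_ hxy
    rw [← ofReal_norm, ← ofReal_norm]
    refine ENNReal.ofReal_le_ofReal ?_
    rw [h1, norm_smul]
    have h2 := norm_add_le (x - (y : 𝔄)) (star (x - (y : 𝔄)))
    rw [norm_star] at h2
    rw [Real.norm_of_nonneg (by norm_num)]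
    linarith

end ConcreteOperatorSystem

/-! ### Admissibility of the bridge and the distance estimate -/

open ConcreteOperatorSystem in
theorem mainTheorem7 {𝔄 : Type*} [CStarAlgebra 𝔄] [PartialOrder 𝔄] [StarOrderedRing 𝔄]
    (X : ConcreteOperatorSystem 𝔄) (L : ExtSeminorm X.toSubmodule) (hL : X.IsCQMS L)
    (Y : ConcreteOperatorSystem 𝔄) (hYX : Y.toSubmodule ≤ X.toSubmodule)
    (K : ExtSeminorm Y.toSubmodule)
    (hK_dense : Dense {y : Y.toSubmodule | K y < ∞})
    (hK_adj : ∀ y : Y.toSubmodule, K y < ∞ → K (Y.adj y) < ∞)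
    (hK_dom : ∀ y : Y.toSubmodule, K y < ∞ → L (Submodule.inclusion hYX y) < ∞)
    (hKL : ∀ y : Y.toSubmodule, K y < ∞ → K y = L (Submodule.inclusion hYX y))
    (ε : ℝ) (hε : 0 < ε)
    (happrox : ∀ x : X.toSubmodule, ∃ y : Y.toSubmodule,
      K y ≤ L x ∧ ‖(x : 𝔄) - (y : 𝔄)‖ₑ ≤ ENNReal.ofReal ε * L x) :
    ∃ hK : Y.IsCQMS K, ConcreteOperatorSystem.qGHDist hL hK ≤ ENNReal.ofReal ε := by
  have hK : Y.IsCQMS K := hL.of_approx hK_dense hK_adj hKL happrox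
  refine ⟨hK, ?_⟩
  have hj := isOrderUnitEmbedding_subtype hL
  have hk := isOrderUnitEmbedding_inclusion hYX hK
  let incl : Y.lipSelfAdjoint K → X.lipSelfAdjoint L := fun b =>
    ⟨Submodule.inclusion hYX b.1, b.2.1, hK_dom _ b.2.2⟩
  refine (iInf₂_le (bridgeSeminorm (X.lipSeminorm L) (Y.lipSeminorm K) _ _ ε) ?_).trans
    (stateHausdorffDist_bridgeSeminorm_le hj hk hε)
  refine ⟨isOrderUnitCQMS_bridgeSeminorm hL hj hk hε le_one_of_lipSeminorm_le_one
    (fun b hb => ?_) hL.lipSeminorm_eq_zero_iff hK.lipSeminorm_eq_zero_iff, fun a => ?_,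
    fun b => ?_⟩
  · have h := le_one_of_lipSeminorm_le_one b hb
    rw [hKL _ b.2.2] at h
    exact h
  · refine le_antisymm ?_ (le_ciInf fun b => (bridgeSeminorm_self_le hε (a, b)).1)
    obtain ⟨y, hKy, hy⟩ := happrox a.1
    obtain ⟨b, hKb, hb⟩ := hK.exists_selfAdjoint_approx a.2.1 a.2.2 hKy hy
    -- The self-adjoint approximant keeps all three terms of the maximum at most L(a), so the
    -- infimum is attained.
    refine ciInf_le_of_le ⟨0, Set.forall_mem_range.2 fun _ => apply_nonneg _ _⟩ b ?_
    refine (bridgeSeminorm_le_iff hε).2 ⟨le_rfl, ENNReal.toReal_mono a.2.2.ne hKb, ?_⟩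
    have h := ENNReal.toReal_mono (ENNReal.mul_lt_top ENNReal.ofReal_lt_top a.2.2).ne hb
    rwa [toReal_enorm, ENNReal.toReal_mul, ENNReal.toReal_ofReal hε.le] at h
  · refine le_antisymm ?_ (le_ciInf fun a => (bridgeSeminorm_self_le hε (a, b)).2)
    -- With a = b the norm term vanishes and the other two terms agree.
    refine ciInf_le_of_le ⟨0, Set.forall_mem_range.2 fun _ => apply_nonneg _ _⟩ (incl b) ?_
    refine (bridgeSeminorm_le_iff hε).2 ⟨?_, le_rfl, ?_⟩
    · rw [lipSeminorm_apply, lipSeminorm_apply, hKL _ b.2.2]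
    · change ‖((Submodule.inclusion hYX b.1 - Submodule.inclusion hYX b.1 : X.toSubmodule) : 𝔄)‖ ≤ _
      rw [sub_self, Submodule.coe_zero, norm_zero]
      exact mul_nonneg hε.le (apply_nonneg _ _)
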